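/- An \emph{information system with witnesses} $(A,\mathrm{Con},\vdash,\Delta)$ consists of a set $A$, an element $\Delta\in A$, a relation $\mathrm{Con}\subseteq A\times\mathcal P_f(A)$ (write $X\in\mathrm{Con}(i)$ for $(i,X)\in\mathrm{Con}$) and a relation ${\vdash}\subseteq\mathrm{Con}\times A$ such that for all $i,j,a\in A$ and all finite $X,Y\subseteq A$, where for $(i,X)\in\mathrm{Con}$ the notation $(i,X)\vdash Y$ means $(i,X)\vdash b$ for all $b\in Y$, and $(i,X)\vdash(j,Y)$ means $(i,X)\vdash j$ and $(i,X)\vdash Y$: (1) $\{i\}\in\mathrm{Con}(i)$; (2) $Y\subseteq X$ and $X\in\mathrm{Con}(i)$ imply $Y\in\mathrm{Con}(i)$; (3) $(i,\emptyset)\vdash\Delta$; (4) $X\in\mathrm{Con}(i)$ and $(i,X)\vdash Y$ imply $Y\in\mathrm{Con}(i)$; (5) $X,Y\in\mathrm{Con}(i)$, $X\subseteq Y$ and $(i,X)\vdash a$ imply $(i,Y)\vdash a$; (6) $X\in\mathrm{Con}(i)$, $(i,X)\vdash Y$ and $(i,Y)\vdash a$ imply $(i,X)\vdash a$; (7) if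 $(i,X)\vdash a$, then there is $Z\in\mathrm{Con}(i)$ with $(i,X)\vdash Z$ and $(i,Z)\vdash a$; (8) if $(i,X)\vdash Y$, then there is $e\in A$ with $(i,X)\vdash e$ and $Y\in\mathrm{Con}(e)$; (9) $\{i\}\in\mathrm{Con}(j)$ implies $\mathrm{Con}(i)\subseteq\mathrm{Con}(j)$; (10) $\{i\}\in\mathrm{Con}(j)$, $X\in\mathrm{Con}(i)$ and $(i,X)\vdash a$ imply $(j,X)\vdash a$; (11) $\{i\}\in\mathrm{Con}(j)$, $X\in\mathrm{Con}(i)$ and $(j,X)\vdash a$ imply $(i,X)\vdash a$. An \emph{approximable mapping} $H$ from $(A,\mathrm{Con},\vdash,\Delta)$ to $(A',\mathrm{Con}',\vdash',\Delta')$ is a relation $H\subseteq\mathrm{Con}\times A'$ such that for all $i,j\in A$, $b,k\in A'$ and all finite $X,X'\subseteq A$, $Y,F\subseteq A'$ with $X\in\mathrm{Con}(i)$ and $Y\in\mathrm{Con}'(k)$, with the analogous abbreviations $(i,X)HF$ and $(i,X)H(k,Y)$: (a) $(\Delta,\emptyset)H\Delta'$; (b) $X'\in\mathrm{Con}(i)$,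 $X\subseteq X'$ and $(i,X)Hb$ imply $(i,X')Hb$; (c) $(i,X)\vdash X'$ and $(i,X')Hb$ imply $(i,X)Hb$; (d) if $(i,X)Hb$, then there is $U\in\mathrm{Con}(i)$ with $(i,X)\vdash U$ and $(i,U)Hb$; (e) $(i,X)H(k,Y)$ and $(k,Y)\vdash' b$ imply $(i,X)Hb$; (f) if $(i,X)Hb$, then there is $(d,V)\in\mathrm{Con}'$ with $(i,X)H(d,V)$ and $(d,V)\vdash' b$; (g) if $(i,X)HF$, then there is $e\in A'$ with $(i,X)He$ and $F\in\mathrm{Con}'(e)$; (h) $\{i\}\in\mathrm{Con}(j)$ and $(i,X)Hb$ imply $(j,X)Hb$; (i) $\{i\}\in\mathrm{Con}(j)$ and $(j,X)Hb$ imply $(i,X)Hb$. Information systems with witnesses and approximable mappings form a category $\mathbf{ISW}$: the identity of $A$ is $\vdash$, and the composite of $H\colon A\to A'$ followed by $G\colon A'\to A''$ relates $(i,X)$ to $c$ if and only if there is $(j,Y)\in\mathrm{Con}'$ with $(i,X)H(j,Y)$ and $(j,Y)Gc$. Consider the following conditions on an information system with witnesses: (ALG) for all $(i,X)\in\mathrm{Con}$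 and all finite $F\subseteq A$ with $(i,X)\vdash F$ there is $(j,V)\in\mathrm{Con}$ with $(j,V)\vdash(j,V)$, $(i,X)\vdash(j,V)$ and $(j,V)\vdash F$; (BC) for all finite $X\subseteq A$ and $i,j\in A$ with $(i,X),(j,X)\in\mathrm{Con}$, and all $a\in A$: $(i,X)\vdash a$ if and only if $(j,X)\vdash a$. Let $\mathbf{aISW}$, $\mathbf{bcISW}$ and $\mathbf{abcISW}$ be the full subcategories of $\mathbf{ISW}$ whose objects satisfy (ALG), (BC), and both (ALG) and (BC), respectively. \textbf{Theorem.} Each of the categories $\mathbf{ISW}$, $\mathbf{aISW}$, $\mathbf{bcISW}$ and $\mathbf{abcISW}$ is Cartesian closed, i.e. it has a terminal object and binary products, and for every object $A$ the functor $A\times(-)$ has a right adjoint. -/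

import Mathlib

open CategoryTheory

universe u v

/-- An information system with witnesses `(A, Con, ⊢, Δ)`. Here `Con i X` reads `X ∈ Con(i)`,
`Ent i X a` reads `(i, X) ⊢ a`, and for a finite set `Y` the expression `(i, X) ⊢ Y` is
spelled out as `∀ y ∈ Y, Ent i X y`. Entailment is a subset of `Con × A` by `con_of_ent`. -/
structure ISW : Type (u + 1) where
  /-- the set of tokens -/
  Token : Type u
  /-- the consistency predicate -/
  Con : Token → Finset Token → Prop
  /-- the entailment relation -/
  Ent : Token → Finset Token → Token → Prop
  /-- the distinguished token `Δ` -/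
  top : Token
  con_of_ent : ∀ {i X a}, Ent i X a → Con i X
  con_self : ∀ i, Con i {i}
  con_subset : ∀ {i X Y}, Y ⊆ X → Con i X → Con i Y
  ent_top : ∀ i, Ent i ∅ top
  con_of_ent_all : ∀ {i X Y}, Con i X → (∀ y ∈ Y, Ent i X y) → Con i Y
  ent_mono : ∀ {i X Y a}, Con i X → Con i Y → X ⊆ Y → Ent i X a → Ent i Y a
  ent_trans : ∀ {i X Y a}, Con i X → (∀ y ∈ Y, Ent i X y) → Ent i Y a → Ent i X a
  ent_interp : ∀ {i X a}, Ent i X a →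
    ∃ Z, Con i Z ∧ (∀ z ∈ Z, Ent i X z) ∧ Ent i Z a
  ent_witness : ∀ {i X Y}, Con i X → (∀ y ∈ Y, Ent i X y) → ∃ e, Ent i X e ∧ Con e Y
  con_wit : ∀ {i j X}, Con j {i} → Con i X → Con j X
  ent_wit : ∀ {i j X a}, Con j {i} → Con i X → Ent i X a → Ent j X a
  ent_conserv : ∀ {i j X a}, Con j {i} → Con i X → Ent j X a → Ent i X a

namespace ISW

/-- Reflexive elements of `Con`: those `(j, V)` with `(j, V) ⊢ (j, V)`. -/
def Reflexive (A : ISW.{u}) (j : A.Token) (V : Finset A.Token) : Prop :=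
  A.Con j V ∧ A.Ent j V j ∧ ∀ v ∈ V, A.Ent j V v

/-- Condition (ALG). -/
def ALG (A : ISW.{u}) : Prop :=
  ∀ (i : A.Token) (X F : Finset A.Token), A.Con i X → (∀ a ∈ F, A.Ent i X a) →
    ∃ (j : A.Token) (V : Finset A.Token), A.Reflexive j V ∧
      (A.Ent i X j ∧ ∀ v ∈ V, A.Ent i X v) ∧ ∀ a ∈ F, A.Ent j V a

/-- Condition (BC). -/
def BC (A : ISW.{u}) : Prop :=
  ∀ (X : Finset A.Token) (i j : A.Token), A.Con i X → A.Con j X →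
    ∀ a, A.Ent i X a ↔ A.Ent j X a

lemma con_empty (A : ISW.{u}) (i : A.Token) : A.Con i ∅ :=
  A.con_subset (Finset.empty_subset _) (A.con_self i)

lemma con_singleton_of_ent (A : ISW.{u}) {i : A.Token} {X : Finset A.Token} {a : A.Token}
    (h : A.Ent i X a) : A.Con i {a} :=
  A.con_of_ent_all (A.con_of_ent h) (by simpa using h)

end ISW

/-- An approximable mapping from `A` to `B`; `Rel i X b` reads `(i, X) H b`. It is a relation
between `Con` and the tokens of `B` by `con_of_rel`. -/
@[ext]
structure ApproxMap (A : ISW.{u}) (B : ISW.{v}) where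
  /-- the underlying relation -/
  Rel : A.Token → Finset A.Token → B.Token → Prop
  con_of_rel : ∀ {i X b}, Rel i X b → A.Con i X
  rel_top : Rel A.top ∅ B.top
  rel_mono : ∀ {i X X' b}, A.Con i X → A.Con i X' → X ⊆ X' → Rel i X b → Rel i X' b
  rel_of_ent : ∀ {i X X' b}, A.Con i X → (∀ x ∈ X', A.Ent i X x) → Rel i X' b → Rel i X b
  left_interp : ∀ {i X b}, Rel i X b →
    ∃ U, A.Con i U ∧ (∀ x ∈ U, A.Ent i X x) ∧ Rel i U b
  rel_ent : ∀ {i X k Y b}, A.Con i X → B.Con k Y → Rel i X k → (∀ y ∈ Y, Rel i X y) →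
    B.Ent k Y b → Rel i X b
  right_interp : ∀ {i X b}, Rel i X b →
    ∃ d V, B.Con d V ∧ (Rel i X d ∧ ∀ y ∈ V, Rel i X y) ∧ B.Ent d V b
  rel_witness : ∀ {i X F}, A.Con i X → (∀ b ∈ F, Rel i X b) → ∃ e, Rel i X e ∧ B.Con e F
  rel_wit : ∀ {i j X b}, A.Con j {i} → A.Con i X → Rel i X b → Rel j X b
  rel_conserv : ∀ {i j X b}, A.Con j {i} → A.Con i X → Rel j X b → Rel i X b

namespace ApproxMap

variable {A B C D : ISW.{u}}

lemma left_interp_finset (H : ApproxMap A B) {i : A.Token} {X : Finset A.Token}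
    (hX : A.Con i X) (F : Finset B.Token) (hF : ∀ b ∈ F, H.Rel i X b) :
    ∃ U, A.Con i U ∧ (∀ x ∈ U, A.Ent i X x) ∧ ∀ b ∈ F, H.Rel i U b := by
  classical
  induction F using Finset.induction_on with
  | empty => exact ⟨∅, A.con_empty i, by simp, by simp⟩
  | insert b F _ ih =>
    obtain ⟨U, hU, hXU, hUF⟩ := ih fun c hc => hF c (Finset.mem_insert_of_mem hc)
    obtain ⟨V, hV, hXV, hVb⟩ := H.left_interp (hF b (Finset.mem_insert_self b F))
    have hent : ∀ x ∈ U ∪ V, A.Ent i X x := by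
      intro x hx
      rcases Finset.mem_union.1 hx with hx | hx
      exacts [hXU x hx, hXV x hx]
    have hc : A.Con i (U ∪ V) := A.con_of_ent_all hX hent
    refine ⟨U ∪ V, hc, hent, fun c hc' => ?_⟩
    rcases Finset.mem_insert.1 hc' with rfl | hc'
    · exact H.rel_mono hV hc Finset.subset_union_right hVb
    · exact H.rel_mono hU hc Finset.subset_union_left (hUF c hc')

lemma rel_of_ent_pair (H : ApproxMap A B) {i j : A.Token} {X Y : Finset A.Token} {b : B.Token}
    (hj : A.Ent i X j) (hY : ∀ y ∈ Y, A.Ent i X y) (h : H.Rel j Y b) : H.Rel i X b :=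
  H.rel_of_ent (A.con_of_ent hj) hY
    (H.rel_wit (A.con_singleton_of_ent hj) (H.con_of_rel h) h)

/-- The identity approximable mapping is the entailment relation. -/
def id (A : ISW.{u}) : ApproxMap A A where
  Rel := A.Ent
  con_of_rel := A.con_of_ent
  rel_top := A.ent_top A.top
  rel_mono := A.ent_mono
  rel_of_ent := A.ent_trans
  left_interp := A.ent_interp
  rel_ent hX hY hk hXY h :=
    A.ent_trans hX hXY (A.ent_wit (A.con_singleton_of_ent hk) hY h)
  right_interp {i X b} h := by
    obtain ⟨Z, hZ, hXZ, hb⟩ := A.ent_interp h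
    obtain ⟨e, he, heZ⟩ := A.ent_witness (A.con_of_ent h) hXZ
    exact ⟨e, Z, heZ, ⟨he, hXZ⟩, A.ent_conserv (A.con_singleton_of_ent he) heZ hb⟩
  rel_witness := A.ent_witness
  rel_wit := A.ent_wit
  rel_conserv := A.ent_conserv

/-- The relation underlying the composition of `H` followed by `G`. -/
def CompRel (H : ApproxMap A B) (G : ApproxMap B C) (i : A.Token) (X : Finset A.Token)
    (c : C.Token) : Prop :=
  ∃ j Y, B.Con j Y ∧ (H.Rel i X j ∧ ∀ y ∈ Y, H.Rel i X y) ∧ G.Rel j Y c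

lemma compRel_finset (H : ApproxMap A B) (G : ApproxMap B C) {i : A.Token}
    {X : Finset A.Token} (hX : A.Con i X) (F : Finset C.Token)
    (hF : ∀ c ∈ F, CompRel H G i X c) :
    ∃ e V, B.Con e V ∧ (H.Rel i X e ∧ ∀ y ∈ V, H.Rel i X y) ∧ ∀ c ∈ F, G.Rel e V c := by
  classical
  induction F using Finset.induction_on with
  | empty =>
    obtain ⟨e, he, _⟩ := H.rel_witness (F := ∅) hX (by simp)
    exact ⟨e, ∅, B.con_empty e, ⟨he, by simp⟩, by simp⟩
  | insert c F _ ih =>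
    obtain ⟨e, V, heV, ⟨he, hV⟩, hVF⟩ := ih fun c hc => hF c (Finset.mem_insert_of_mem hc)
    obtain ⟨j, Y, hjY, ⟨hj, hY⟩, hYc⟩ := hF c (Finset.mem_insert_self c F)
    obtain ⟨k, hk, hkc⟩ := H.rel_witness (F := insert e (insert j (V ∪ Y))) hX (by
      intro b hb
      simp only [Finset.mem_insert, Finset.mem_union] at hb
      rcases hb with rfl | rfl | hb | hb
      exacts [he, hj, hV b hb, hY b hb])
    have hke : B.Con k {e} := B.con_subset (by simp) hkc
    have hkj : B.Con k {j} := B.con_subset (by simp) hkc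
    have hVY : B.Con k (V ∪ Y) := B.con_subset
      ((Finset.subset_insert _ _).trans (Finset.subset_insert _ _)) hkc
    refine ⟨k, V ∪ Y, hVY, ⟨hk, fun y hy => ?_⟩, fun d hd => ?_⟩
    · rcases Finset.mem_union.1 hy with hy | hy
      exacts [hV y hy, hY y hy]
    · rcases Finset.mem_insert.1 hd with rfl | hd
      · exact G.rel_mono (B.con_wit hkj hjY) hVY Finset.subset_union_right
          (G.rel_wit hkj hjY hYc)
      · exact G.rel_mono (B.con_wit hke heV) hVY Finset.subset_union_left
          (G.rel_wit hke heV (hVF d hd))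

/-- Composition of approximable mappings, `H` first and then `G`. -/
def comp (H : ApproxMap A B) (G : ApproxMap B C) : ApproxMap A C where
  Rel := CompRel H G
  con_of_rel := fun ⟨_, _, _, ⟨hj, _⟩, _⟩ => H.con_of_rel hj
  rel_top := ⟨B.top, ∅, B.con_empty _, ⟨H.rel_top, by simp⟩, G.rel_top⟩
  rel_mono := fun hX hX' hs ⟨j, Y, hjY, ⟨hj, hY⟩, h⟩ =>
    ⟨j, Y, hjY, ⟨H.rel_mono hX hX' hs hj, fun y hy => H.rel_mono hX hX' hs (hY y hy)⟩, h⟩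
  rel_of_ent := fun hX hX' ⟨j, Y, hjY, ⟨hj, hY⟩, h⟩ =>
    ⟨j, Y, hjY, ⟨H.rel_of_ent hX hX' hj, fun y hy => H.rel_of_ent hX hX' (hY y hy)⟩, h⟩
  left_interp := by
    classical
    rintro i X c ⟨j, Y, hjY, ⟨hj, hY⟩, h⟩
    obtain ⟨U, hU, hXU, hUF⟩ := H.left_interp_finset (H.con_of_rel hj) (insert j Y) (by
      intro b hb
      rcases Finset.mem_insert.1 hb with rfl | hb
      exacts [hj, hY b hb])
    exact ⟨U, hU, hXU, j, Y, hjY, ⟨hUF j (Finset.mem_insert_self _ _),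
      fun y hy => hUF y (Finset.mem_insert_of_mem hy)⟩, h⟩
  rel_ent := by
    classical
    intro i X k Y b hX hkY hk hY h
    obtain ⟨e, V, heV, hH, hG⟩ := compRel_finset H G hX (insert k Y) (by
      intro b hb
      rcases Finset.mem_insert.1 hb with rfl | hb
      exacts [hk, hY b hb])
    exact ⟨e, V, heV, hH, G.rel_ent heV hkY (hG k (Finset.mem_insert_self _ _))
      (fun y hy => hG y (Finset.mem_insert_of_mem hy)) h⟩
  right_interp := by
    rintro i X c ⟨j, Y, hjY, hH, h⟩
    obtain ⟨d, V, hdV, ⟨hd, hV⟩, hc⟩ := G.right_interp h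
    exact ⟨d, V, hdV, ⟨⟨j, Y, hjY, hH, hd⟩, fun y hy => ⟨j, Y, hjY, hH, hV y hy⟩⟩, hc⟩
  rel_witness := by
    intro i X F hX hF
    obtain ⟨e, V, heV, hH, hG⟩ := compRel_finset H G hX F hF
    obtain ⟨k, hk, hkF⟩ := G.rel_witness heV hG
    exact ⟨k, ⟨e, V, heV, hH, hk⟩, hkF⟩
  rel_wit := fun hi hX ⟨j, Y, hjY, ⟨hj, hY⟩, h⟩ =>
    ⟨j, Y, hjY, ⟨H.rel_wit hi hX hj, fun y hy => H.rel_wit hi hX (hY y hy)⟩, h⟩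
  rel_conserv := fun hi hX ⟨j, Y, hjY, ⟨hj, hY⟩, h⟩ =>
    ⟨j, Y, hjY, ⟨H.rel_conserv hi hX hj, fun y hy => H.rel_conserv hi hX (hY y hy)⟩, h⟩

lemma id_comp' (H : ApproxMap A B) : comp (id A) H = H := by
  ext i X b
  constructor
  · rintro ⟨j, Y, _, ⟨hj, hY⟩, h⟩
    exact H.rel_of_ent_pair hj hY h
  · intro h
    obtain ⟨U, hU, hXU, hUb⟩ := H.left_interp h
    obtain ⟨c, hc, hcU⟩ := A.ent_witness (H.con_of_rel h) hXU
    exact ⟨c, U, hcU, ⟨hc, hXU⟩, H.rel_conserv (A.con_singleton_of_ent hc) hcU hUb⟩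

lemma comp_id' (H : ApproxMap A B) : comp H (id B) = H := by
  ext i X b
  constructor
  · rintro ⟨j, Y, hjY, ⟨hj, hY⟩, h⟩
    exact H.rel_ent (H.con_of_rel hj) hjY hj hY h
  · intro h
    exact H.right_interp h

lemma assoc' (H : ApproxMap A B) (G : ApproxMap B C) (K : ApproxMap C D) :
    comp (comp H G) K = comp H (comp G K) := by
  classical
  ext i X d
  constructor
  · rintro ⟨k, Z, hkZ, ⟨hk, hZ⟩, h⟩
    obtain ⟨e, V, heV, hH, hG⟩ := compRel_finset H G ((comp H G).con_of_rel hk) (insert k Z) (by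
      intro b hb
      rcases Finset.mem_insert.1 hb with rfl | hb
      exacts [hk, hZ b hb])
    exact ⟨e, V, heV, hH, k, Z, hkZ, ⟨hG k (Finset.mem_insert_self _ _),
      fun y hy => hG y (Finset.mem_insert_of_mem hy)⟩, h⟩
  · rintro ⟨j, Y, hjY, hH, k, Z, hkZ, ⟨hk, hZ⟩, h⟩
    exact ⟨k, Z, hkZ, ⟨⟨j, Y, hjY, hH, hk⟩, fun z hz => ⟨j, Y, hjY, hH, hZ z hz⟩⟩, h⟩

end ApproxMap

/-- The category of information systems with witnesses and approximable mappings. -/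
instance ISW.category : Category.{u} ISW.{u} where
  Hom A B := ApproxMap A B
  id A := ApproxMap.id A
  comp H G := ApproxMap.comp H G
  id_comp H := ApproxMap.id_comp' H
  comp_id H := ApproxMap.comp_id' H
  assoc H G K := ApproxMap.assoc' H G K

/-- The full subcategory of information systems with witnesses that satisfy (ALG). -/
abbrev aISW : Type (u + 1) := ObjectProperty.FullSubcategory fun A : ISW.{u} => A.ALG

/-- The full subcategory of information systems with witnesses that satisfy (BC). -/
abbrev bcISW : Type (u + 1) := ObjectProperty.FullSubcategory fun A : ISW.{u} => A.BC

/-- The full subcategory of information systems with witnesses that satisfy (ALG) and (BC). -/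
abbrev abcISW : Type (u + 1) :=
  ObjectProperty.FullSubcategory fun A : ISW.{u} => A.ALG ∧ A.BC

/-- A category is Cartesian closed if it has finite products (a terminal object and binary
products) and, for every object `A`, the functor `A × -` has a right adjoint. -/
def IsCartesianClosed (C : Type v) [Category.{u} C] : Prop :=
  ∃ _ : CartesianMonoidalCategory C, Nonempty (MonoidalClosed C)

/-! All four categories are equivalent to categories of domains with Scott-continuous maps, and
Cartesian closedness is proved there and transported.

The states of an information system, ordered by inclusion, form a continuous L-domain in which the
principal states `{a | (i, X) ⊢ a}` act as a basis. A Scott-continuous function is determined by its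
values on principal states, and those values are exactly the data of an approximable mapping; so
`stateMap` is injective on morphisms and `ofScottMap` gives preimages. Conversely, a continuous
L-domain `D` yields the system `ofLDomain D`, whose states are the sets `{a | a ≪ d}` and hence
recover `D` (`orderIsoState`). Under this correspondence (ALG) matches algebraicity and (BC) matches
bounded completeness.

On the domain side the product is componentwise and the exponential is the pointwise ordered
function space. The crux is that the function space is again an L-domain. Suprema in principal
ideals do not change when the ideal grows (`IsLocalLUB.of_le`), so pointwise local suprema are
Scott-continuous; and step functions, way below `f` by `step_wayBelow`, are numerous enough to have
supremum `f`. -/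

section DomainTheory

/-! ### Way-below relation and local suprema in L-domains -/

open Set

variable {D : Type*} {E : Type*} {F : Type*} [PartialOrder D] [PartialOrder E] [PartialOrder F]

/-- The way-below relation of a partial order. -/
def WayBelow (a b : D) : Prop :=
  ∀ S : Set D, S.Nonempty → DirectedOn (· ≤ ·) S → ∀ s, IsLUB S s → b ≤ s → ∃ c ∈ S, a ≤ c

/-- `s` is the least upper bound of `S` in the principal ideal of `i`. -/
def IsLocalLUB (i : D) (S : Set D) (s : D) : Prop :=
  IsLeast (upperBounds S ∩ Iic i) s

/-- Continuous L-domains: pointed directed-complete partial orders in which each principal ideal is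
a complete lattice and each element is the supremum of the elements way below it. -/
class IsLDomain (D : Type*) [PartialOrder D] : Prop where
  exists_isBot : ∃ b : D, IsBot b
  exists_isLUB : ∀ S : Set D, S.Nonempty → DirectedOn (· ≤ ·) S → ∃ s, IsLUB S s
  exists_isLocalLUB : ∀ (i : D) (S : Set D), S ⊆ Iic i → ∃ s, IsLocalLUB i S s
  le_of_wayBelow : ∀ x y : D, (∀ a, WayBelow a x → a ≤ y) → x ≤ y

/-- Each element is the supremum of the compact elements below it. -/
def IsAlgebraicDomain (D : Type*) [PartialOrder D] : Prop :=
  ∀ x y : D, (∀ k, WayBelow k k → k ≤ x → k ≤ y) → x ≤ y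

/-- Each bounded subset has a least upper bound. -/
def IsBoundedComplete (D : Type*) [PartialOrder D] : Prop :=
  ∀ S : Set D, BddAbove S → ∃ s, IsLUB S s

lemma DirectedOn.exists_forall_le_of_finite {S T : Set D} (hS : S.Nonempty)
    (hd : DirectedOn (· ≤ ·) S) (hT : T.Finite) (h : ∀ a ∈ T, ∃ c ∈ S, a ≤ c) :
    ∃ c ∈ S, ∀ a ∈ T, a ≤ c := by
  induction T, hT using Set.Finite.induction_on with
  | empty => exact ⟨_, hS.some_mem, by simp⟩
  | @insert a T _ _ ih =>
    obtain ⟨c, hc, hTc⟩ := ih fun b hb => h b (mem_insert_of_mem a hb)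
    obtain ⟨d, hd', had⟩ := h a (mem_insert a T)
    obtain ⟨e, he, hce, hde⟩ := hd c hc d hd'
    refine ⟨e, he, ?_⟩
    rintro b (rfl | hb)
    exacts [had.trans hde, (hTc b hb).trans hce]

namespace WayBelow

lemma le {a b : D} (h : WayBelow a b) : a ≤ b := by
  obtain ⟨c, rfl, hc⟩ := h {b} (singleton_nonempty b) (directedOn_singleton b) b
    isLUB_singleton le_rfl
  exact hc

lemma trans_le {a b c : D} (h : WayBelow a b) (hbc : b ≤ c) : WayBelow a c :=
  fun S hS hd s hs hc => h S hS hd s hs (hbc.trans hc)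

lemma of_le {a b c : D} (hab : a ≤ b) (h : WayBelow b c) : WayBelow a c :=
  fun S hS hd s hs hc =>
    let ⟨d, hd', hbd⟩ := h S hS hd s hs hc
    ⟨d, hd', hab.trans hbd⟩

lemma of_isBot {b : D} (hb : IsBot b) (x : D) : WayBelow b x :=
  fun _ ⟨c, hc⟩ _ _ _ _ => ⟨c, hc, hb c⟩

lemma prodMk {a x : D} {b y : E} (ha : WayBelow a x) (hb : WayBelow b y) :
    WayBelow (a, b) (x, y) := by
  rintro S hS hd ⟨s, t⟩ hs ⟨hxs, hyt⟩
  obtain ⟨hs, ht⟩ := isLUB_prod.1 hs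
  obtain ⟨_, ⟨p, hp, rfl⟩, hap⟩ := ha _ (hS.image _) hd.fst _ hs hxs
  obtain ⟨_, ⟨q, hq, rfl⟩, hbq⟩ := hb _ (hS.image _) hd.snd _ ht hyt
  obtain ⟨r, hr, hpr, hqr⟩ := hd p hp q hq
  exact ⟨r, hr, hap.trans hpr.1, hbq.trans hqr.2⟩

end WayBelow

namespace IsLocalLUB

lemma le {i s : D} {S : Set D} (h : IsLocalLUB i S s) : s ≤ i := h.1.2

lemma mem_upperBounds {i s : D} {S : Set D} (h : IsLocalLUB i S s) : s ∈ upperBounds S := h.1.1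

lemma subset_Iic {i s : D} {S : Set D} (h : IsLocalLUB i S s) : S ⊆ Iic i :=
  fun _ hx => (h.mem_upperBounds hx).trans h.le

/-- The supremum `t` in the larger ideal lies below `i`, because `i` is itself an upper bound of `S`
below `j`. So `t` competes in the smaller ideal, which gives `s ≤ t`. -/
lemma of_le [IsLDomain D] {i j s : D} {S : Set D} (h : IsLocalLUB i S s) (hij : i ≤ j) :
    IsLocalLUB j S s := by
  obtain ⟨t, ht⟩ := IsLDomain.exists_isLocalLUB j S
    (h.subset_Iic.trans (Iic_subset_Iic.2 hij))
  have hst : s ≤ t := h.2 ⟨ht.1.1, ht.2 ⟨h.subset_Iic, hij⟩⟩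
  exact ⟨⟨h.1.1, h.le.trans hij⟩, fun u hu => hst.trans (ht.2 hu)⟩

lemma unique_of_le [IsLDomain D] {i j s t : D} {S : Set D} (hs : IsLocalLUB i S s)
    (ht : IsLocalLUB j S t) (hij : i ≤ j) : s = t :=
  (hs.of_le hij).unique ht

lemma le_of_mem_upperBounds [IsLDomain D] {i j s t : D} {S : Set D} (hs : IsLocalLUB i S s)
    (ht : t ∈ upperBounds S) (hij : i ≤ j) (htj : t ≤ j) : s ≤ t :=
  (hs.of_le hij).2 ⟨ht, htj⟩

/-- A directed set whose supremum `t` is above `x` has a member `c` above all of the finite set `S`.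
Both `x` and `c` lie below `t`, so independence of the ideal gives `s ≤ c`. -/
lemma wayBelow [IsLDomain D] {x s : D} {S : Set D} (hs : IsLocalLUB x S s) (hS : S.Finite)
    (h : ∀ a ∈ S, WayBelow a x) : WayBelow s x := by
  intro T hT hd t ht hxt
  obtain ⟨c, hc, hSc⟩ := hd.exists_forall_le_of_finite hT hS
    fun a ha => h a ha T hT hd t ht hxt
  exact ⟨c, hc, hs.le_of_mem_upperBounds hSc hxt (ht.1 hc)⟩

end IsLocalLUB

lemma IsAlgebraicDomain.isLUB_compact (h : IsAlgebraicDomain D) (x : D) :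
    IsLUB {k | WayBelow k k ∧ k ≤ x} x :=
  ⟨fun _ hk => hk.2, fun y hy => h x y fun _ hk hkx => hy ⟨hk, hkx⟩⟩

section IsLDomain

variable [IsLDomain D] [IsLDomain E]

open IsLDomain

lemma exists_wayBelow_forall_le {x : D} {T : Set D} (hT : T.Finite)
    (h : ∀ a ∈ T, WayBelow a x) : ∃ e, WayBelow e x ∧ ∀ a ∈ T, a ≤ e := by
  obtain ⟨s, hs⟩ := exists_isLocalLUB x T fun a ha => (h a ha).le
  exact ⟨s, hs.wayBelow hT h, hs.mem_upperBounds⟩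

lemma directedOn_wayBelow (x : D) : DirectedOn (· ≤ ·) {a | WayBelow a x} := by
  intro a ha b hb
  obtain ⟨e, he, h⟩ := exists_wayBelow_forall_le (T := {a, b}) (x := x) (by simp)
    (by simpa using ⟨ha, hb⟩)
  exact ⟨e, he, h a (by simp), h b (by simp)⟩

lemma nonempty_wayBelow (x : D) : {a | WayBelow a x}.Nonempty :=
  let ⟨b, hb⟩ := exists_isBot (D := D)
  ⟨b, .of_isBot hb x⟩

lemma isLUB_wayBelow (x : D) : IsLUB {a | WayBelow a x} x :=
  ⟨fun _ ha => ha.le, fun y hy => le_of_wayBelow x y fun _ ha => hy ha⟩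

/-- The elements `z` with `z ≪ w ≪ x` for some `w` form a directed set with supremum `x`, so `a`
lies below one of them. -/
lemma WayBelow.exists_between {a x : D} (h : WayBelow a x) :
    ∃ z, WayBelow a z ∧ WayBelow z x := by
  have hne : {z | ∃ w, WayBelow z w ∧ WayBelow w x}.Nonempty := by
    obtain ⟨w, hw⟩ := nonempty_wayBelow x
    obtain ⟨z, hz⟩ := nonempty_wayBelow w
    exact ⟨z, w, hz, hw⟩
  have hdir : DirectedOn (· ≤ ·) {z | ∃ w, WayBelow z w ∧ WayBelow w x} := by
    rintro z ⟨w, hzw, hwx⟩ z' ⟨w', hzw', hwx'⟩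
    obtain ⟨v, hv, hwv, hwv'⟩ := directedOn_wayBelow x w hwx w' hwx'
    obtain ⟨y, hy, hzy, hzy'⟩ := directedOn_wayBelow v z (hzw.trans_le hwv) z' (hzw'.trans_le hwv')
    exact ⟨y, ⟨v, hy, hv⟩, hzy, hzy'⟩
  have hlub : IsLUB {z | ∃ w, WayBelow z w ∧ WayBelow w x} x :=
    ⟨fun z ⟨w, hzw, hwx⟩ => hzw.le.trans hwx.le, fun u hu =>
      le_of_wayBelow x u fun w hw => le_of_wayBelow w u fun z hz => hu ⟨w, hz, hw⟩⟩
  obtain ⟨z, ⟨w, hzw, hwx⟩, haz⟩ := h _ hne hdir x hlub le_rfl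
  exact ⟨w, .of_le haz hzw, hwx⟩

lemma directedOn_compact (x : D) : DirectedOn (· ≤ ·) {k | WayBelow k k ∧ k ≤ x} := by
  rintro a ⟨ha, hax⟩ b ⟨hb, hbx⟩
  obtain ⟨s, hs⟩ := exists_isLocalLUB x {a, b} (by simp [insert_subset_iff, hax, hbx])
  have has : a ≤ s := hs.mem_upperBounds (by simp)
  have hbs : b ≤ s := hs.mem_upperBounds (by simp)
  -- Shrinking the ideal to that of `s` itself makes the finite-supremum criterion yield `s ≪ s`.
  have hs' : IsLocalLUB s {a, b} s := ⟨⟨hs.1.1, le_rfl⟩, fun u hu => hs.2 ⟨hu.1, hu.2.trans hs.le⟩⟩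
  refine ⟨s, ⟨hs'.wayBelow (by simp) ?_, hs.le⟩, has, hbs⟩
  rintro c (rfl | rfl)
  exacts [ha.trans_le has, hb.trans_le hbs]

lemma nonempty_compact (x : D) : {k | WayBelow k k ∧ k ≤ x}.Nonempty :=
  let ⟨b, hb⟩ := exists_isBot (D := D)
  ⟨b, .of_isBot hb b, hb x⟩

end IsLDomain

/-! ### One-point domain and binary products -/

section Instances

instance : IsLDomain PUnit.{u + 1} where
  exists_isBot := ⟨⟨⟩, fun _ => trivial⟩
  exists_isLUB _ _ _ := ⟨⟨⟩, fun _ _ => trivial, fun _ _ => trivial⟩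
  exists_isLocalLUB _ _ _ := ⟨⟨⟩, ⟨fun _ _ => trivial, trivial⟩, fun _ _ => trivial⟩
  le_of_wayBelow _ _ _ := trivial

lemma isAlgebraicDomain_punit : IsAlgebraicDomain PUnit.{u + 1} := fun _ _ _ => trivial

lemma isBoundedComplete_punit : IsBoundedComplete PUnit.{u + 1} :=
  fun _ _ => ⟨⟨⟩, fun _ _ => trivial, fun _ _ => trivial⟩

lemma IsLocalLUB.prodMk {i s : D} {j t : E} {S : Set (D × E)}
    (hs : IsLocalLUB i (Prod.fst '' S) s) (ht : IsLocalLUB j (Prod.snd '' S) t) :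
    IsLocalLUB (i, j) S (s, t) := by
  refine ⟨⟨fun p hp => ⟨hs.1.1 ⟨p, hp, rfl⟩, ht.1.1 ⟨p, hp, rfl⟩⟩, hs.le, ht.le⟩, ?_⟩
  rintro u ⟨hu, hui⟩
  refine ⟨hs.2 ⟨?_, hui.1⟩, ht.2 ⟨?_, hui.2⟩⟩
  · rintro _ ⟨p, hp, rfl⟩
    exact (hu hp).1
  · rintro _ ⟨p, hp, rfl⟩
    exact (hu hp).2

instance [IsLDomain D] [IsLDomain E] : IsLDomain (D × E) where
  exists_isBot :=
    let ⟨a, ha⟩ := IsLDomain.exists_isBot (D := D)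
    let ⟨b, hb⟩ := IsLDomain.exists_isBot (D := E)
    ⟨(a, b), fun p => ⟨ha p.1, hb p.2⟩⟩
  exists_isLUB S hS hd :=
    let ⟨s, hs⟩ := IsLDomain.exists_isLUB _ (hS.image _) hd.fst
    let ⟨t, ht⟩ := IsLDomain.exists_isLUB _ (hS.image _) hd.snd
    ⟨(s, t), isLUB_prod.2 ⟨hs, ht⟩⟩
  exists_isLocalLUB i S hS := by
    obtain ⟨s, hs⟩ := IsLDomain.exists_isLocalLUB i.1 (Prod.fst '' S) (by
      rintro _ ⟨p, hp, rfl⟩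
      exact (hS hp).1)
    obtain ⟨t, ht⟩ := IsLDomain.exists_isLocalLUB i.2 (Prod.snd '' S) (by
      rintro _ ⟨p, hp, rfl⟩
      exact (hS hp).2)
    exact ⟨(s, t), hs.prodMk ht⟩
  le_of_wayBelow := by
    rintro ⟨x, y⟩ ⟨x', y'⟩ h
    obtain ⟨a, ha⟩ := IsLDomain.exists_isBot (D := D)
    obtain ⟨b, hb⟩ := IsLDomain.exists_isBot (D := E)
    -- Padding with a bottom element keeps a pair way below `(x, y)`, so each coordinate can be
    -- tested alone.
    exact ⟨IsLDomain.le_of_wayBelow _ _ fun c hc => (h (c, b) (hc.prodMk (.of_isBot hb y))).1,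
      IsLDomain.le_of_wayBelow _ _ fun c hc =>
        (h (a, c) (WayBelow.prodMk (.of_isBot ha x) hc)).2⟩

lemma IsAlgebraicDomain.prod [IsLDomain D] [IsLDomain E] (hD : IsAlgebraicDomain D)
    (hE : IsAlgebraicDomain E) : IsAlgebraicDomain (D × E) := by
  rintro ⟨x, y⟩ ⟨x', y'⟩ h
  obtain ⟨a, ha⟩ := IsLDomain.exists_isBot (D := D)
  obtain ⟨b, hb⟩ := IsLDomain.exists_isBot (D := E)
  exact ⟨hD _ _ fun k hk hkx => (h (k, b) (hk.prodMk (.of_isBot hb b)) ⟨hkx, hb y⟩).1,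
    hE _ _ fun k hk hky => (h (a, k) (WayBelow.prodMk (.of_isBot ha a) hk) ⟨ha x, hky⟩).2⟩

lemma IsBoundedComplete.prod (hD : IsBoundedComplete D) (hE : IsBoundedComplete E) :
    IsBoundedComplete (D × E) := by
  rintro S ⟨b, hb⟩
  obtain ⟨s, hs⟩ := hD (Prod.fst '' S) ⟨b.1, by rintro _ ⟨p, hp, rfl⟩; exact (hb hp).1⟩
  obtain ⟨t, ht⟩ := hE (Prod.snd '' S) ⟨b.2, by rintro _ ⟨p, hp, rfl⟩; exact (hb hp).2⟩
  exact ⟨(s, t), isLUB_prod.2 ⟨hs, ht⟩⟩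

end Instances

variable (D E) in
/-- Scott-continuous functions, ordered pointwise. -/
abbrev ScottMap := {f : D → E // ScottContinuous f}

/-! ### Function spaces -/

namespace ScottMap

lemma scottContinuous_of_isLUB {S : Set (ScottMap D E)} {f : D → E}
    (h : ∀ x, IsLUB ((fun g : ScottMap D E => g.1 x) '' S) (f x)) : ScottContinuous f := by
  intro d hd hdir a ha
  refine ⟨?_, fun u hu => (h a).2 ?_⟩
  · rintro _ ⟨b, hb, rfl⟩
    refine (h b).2 ?_
    rintro _ ⟨g, hg, rfl⟩
    exact (g.2.monotone (ha.1 hb)).trans ((h a).1 ⟨g, hg, rfl⟩)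
  · rintro _ ⟨g, hg, rfl⟩
    refine (g.2 hd hdir ha).2 ?_
    rintro _ ⟨b, hb, rfl⟩
    exact ((h b).1 ⟨g, hg, rfl⟩).trans (hu ⟨b, hb, rfl⟩)

lemma isLUB_of_forall {S : Set (ScottMap D E)} {f : ScottMap D E}
    (h : ∀ x, IsLUB ((fun g : ScottMap D E => g.1 x) '' S) (f.1 x)) : IsLUB S f :=
  ⟨fun g hg x => (h x).1 ⟨g, hg, rfl⟩, fun u hu x => (h x).2 (by
    rintro _ ⟨g, hg, rfl⟩
    exact hu hg x)⟩

lemma directedOn_apply {S : Set (ScottMap D E)} (hS : DirectedOn (· ≤ ·) S) (x : D) :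
    DirectedOn (· ≤ ·) ((fun g : ScottMap D E => g.1 x) '' S) := by
  rintro _ ⟨g, hg, rfl⟩ _ ⟨h, hh, rfl⟩
  obtain ⟨k, hk, hgk, hhk⟩ := hS g hg h hh
  exact ⟨_, ⟨k, hk, rfl⟩, hgk x, hhk x⟩

lemma exists_isLUB_of_forall {S : Set (ScottMap D E)}
    (h : ∀ x, ∃ s, IsLUB ((fun g : ScottMap D E => g.1 x) '' S) s) :
    ∃ f : ScottMap D E, ∀ x, IsLUB ((fun g : ScottMap D E => g.1 x) '' S) (f.1 x) := by
  choose f hf using h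
  exact ⟨⟨f, scottContinuous_of_isLUB hf⟩, hf⟩

/-- Directed pointwise suprema exist and are Scott-continuous, so uniqueness identifies them with
the given supremum. -/
lemma isLUB_apply [IsLDomain E] {S : Set (ScottMap D E)} (hS : S.Nonempty)
    (hd : DirectedOn (· ≤ ·) S) {f : ScottMap D E} (hf : IsLUB S f) (x : D) :
    IsLUB ((fun g : ScottMap D E => g.1 x) '' S) (f.1 x) := by
  obtain ⟨g, hg⟩ := exists_isLUB_of_forall fun x =>
    IsLDomain.exists_isLUB _ (hS.image _) (directedOn_apply hd x)
  rw [hf.unique (isLUB_of_forall hg)]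
  exact hg x

open Classical in
/-- The step function with value `e` on the elements way above `d`. -/
noncomputable def step [IsLDomain D] {b : E} (hb : IsBot b) (d : D) (e : E) : ScottMap D E :=
  ⟨fun x => if WayBelow d x then e else b, by
    intro S hS hd a ha
    have hmono : ∀ x ≤ a, (if WayBelow d x then e else b) ≤ (if WayBelow d a then e else b) := by
      intro x hx
      split_ifs with h₁ h₂
      · exact le_rfl
      · exact (h₂ (h₁.trans_le hx)).elim
      · exact hb e
      · exact le_rfl
    refine ⟨?_, fun u hu => ?_⟩
    · rintro _ ⟨x, hx, rfl⟩
      exact hmono x (ha.1 hx)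
    · dsimp only
      split_ifs with h
      -- Interpolation makes the set of elements way above `d` Scott-open: some member of `S` is
      -- above `z`, hence way above `d`.
      · obtain ⟨z, hdz, hza⟩ := h.exists_between
        obtain ⟨c, hc, hzc⟩ := hza S hS hd a ha le_rfl
        simpa [hdz.trans_le hzc] using hu ⟨c, hc, rfl⟩
      · exact hb u⟩

lemma step_apply_of_wayBelow [IsLDomain D] {b : E} (hb : IsBot b) {d x : D} (e : E)
    (h : WayBelow d x) : (step hb d e).1 x = e := if_pos h

lemma step_le_of_le [IsLDomain D] {b : E} (hb : IsBot b) {d : D} {e : E} {f : ScottMap D E}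
    (h : e ≤ f.1 d) : step hb d e ≤ f := by
  intro x
  dsimp only [step]
  split_ifs with hx
  · exact h.trans (f.2.monotone hx.le)
  · exact hb _

/-- Directed suprema are computed at the point `d`, so `e ≤ g d` for some `g` in the family; this
one inequality already puts the step function below `g`. -/
lemma step_wayBelow [IsLDomain D] [IsLDomain E] {b : E} (hb : IsBot b) {d : D} {e : E}
    {f : ScottMap D E} (h : WayBelow e (f.1 d)) : WayBelow (step hb d e) f := by
  intro S hS hd s hs hfs
  obtain ⟨_, ⟨g, hg, rfl⟩, he⟩ := h _ (hS.image _) (directedOn_apply hd d) _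
    (isLUB_apply hS hd hs d) (hfs d)
  exact ⟨g, hg, step_le_of_le hb he⟩

lemma isLocalLUB_of_forall {S : Set (ScottMap D E)} {f g : ScottMap D E}
    (h : ∀ x, IsLocalLUB (f.1 x) ((fun k : ScottMap D E => k.1 x) '' S) (g.1 x)) :
    IsLocalLUB f S g :=
  ⟨⟨fun k hk x => (h x).1.1 ⟨k, hk, rfl⟩, fun x => (h x).le⟩, fun u hu x => (h x).2 ⟨by
    rintro _ ⟨k, hk, rfl⟩
    exact hu.1 hk x, hu.2 x⟩⟩

lemma exists_isLocalLUB [IsLDomain E] (f : ScottMap D E) (S : Set (ScottMap D E))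
    (hS : S ⊆ Iic f) : ∃ g, IsLocalLUB f S g := by
  have hex : ∀ x, ∃ s, IsLocalLUB (f.1 x) ((fun k : ScottMap D E => k.1 x) '' S) s := fun x =>
    IsLDomain.exists_isLocalLUB _ _ (by
      rintro _ ⟨k, hk, rfl⟩
      exact hS hk x)
  choose g hg using hex
  refine ⟨⟨g, ?_⟩, isLocalLUB_of_forall hg⟩
  intro T hT hd a ha
  refine ⟨?_, fun u hu => ?_⟩
  · rintro _ ⟨x, hx, rfl⟩
    -- The suprema defining `g x` and `g a` live in different ideals; they are comparable because `f
    -- x ≤ f a`.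
    refine (hg x).le_of_mem_upperBounds ?_ (f.2.monotone (ha.1 hx)) (hg a).le
    rintro _ ⟨k, hk, rfl⟩
    exact (k.2.monotone (ha.1 hx)).trans ((hg a).1.1 ⟨k, hk, rfl⟩)
  · obtain ⟨v, hv⟩ := IsLDomain.exists_isLUB (g '' T) (hT.image g) (by
      rintro _ ⟨x, hx, rfl⟩ _ ⟨y, hy, rfl⟩
      obtain ⟨z, hz, hxz, hyz⟩ := hd x hx y hy
      have hle : ∀ w ≤ z, g w ≤ g z := fun w hw =>
        (hg w).le_of_mem_upperBounds (by
          rintro _ ⟨k, hk, rfl⟩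
          exact (k.2.monotone hw).trans ((hg z).1.1 ⟨k, hk, rfl⟩)) (f.2.monotone hw) (hg z).le
      exact ⟨g z, ⟨z, hz, rfl⟩, hle x hxz, hle y hyz⟩)
    -- The supremum `v` of `g` over `T` stays below `f a` and bounds every `k a`, by continuity of
    -- `k`. It is therefore a competitor in the definition of `g a`.
    refine le_trans ((hg a).2 ⟨?_, ?_⟩) (hv.2 hu)
    · rintro _ ⟨k, hk, rfl⟩
      refine (k.2 hT hd ha).2 ?_
      rintro _ ⟨x, hx, rfl⟩
      exact ((hg x).1.1 ⟨k, hk, rfl⟩).trans (hv.1 ⟨x, hx, rfl⟩)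
    · refine hv.2 ?_
      rintro _ ⟨x, hx, rfl⟩
      exact (hg x).le.trans (f.2.monotone (ha.1 hx))

instance [IsLDomain D] [IsLDomain E] : IsLDomain (ScottMap D E) where
  exists_isBot :=
    let ⟨b, hb⟩ := IsLDomain.exists_isBot (D := E)
    ⟨⟨Function.const D b, .const b⟩, fun f x => hb (f.1 x)⟩
  exists_isLUB S hS hd :=
    let ⟨f, hf⟩ := exists_isLUB_of_forall fun x =>
      IsLDomain.exists_isLUB _ (hS.image _) (directedOn_apply hd x)
    ⟨f, isLUB_of_forall hf⟩
  exists_isLocalLUB := exists_isLocalLUB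
  le_of_wayBelow f g h x := by
    obtain ⟨b, hb⟩ := IsLDomain.exists_isBot (D := E)
    -- Continuity of `f` and of `E` reduces the claim to `e ≤ g x` for `d ≪ x` and `e ≪ f d`; the
    -- step function from `d` to `e` tests exactly this.
    refine (f.2 (nonempty_wayBelow x) (directedOn_wayBelow x) (isLUB_wayBelow x)).2 ?_
    rintro _ ⟨d, hd, rfl⟩
    refine IsLDomain.le_of_wayBelow _ _ fun e he => ?_
    simpa only [step_apply_of_wayBelow hb e hd] using h _ (step_wayBelow hb he) x

/-- Step functions built from compact `d` and `e` are compact, since their value at `d` is `e`, and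
they suffice to test the order. -/
lemma isAlgebraicDomain [IsLDomain D] [IsLDomain E] (hD : IsAlgebraicDomain D)
    (hE : IsAlgebraicDomain E) : IsAlgebraicDomain (ScottMap D E) := by
  intro f g h x
  obtain ⟨b, hb⟩ := IsLDomain.exists_isBot (D := E)
  refine (f.2 (nonempty_compact x) (directedOn_compact x) (hD.isLUB_compact x)).2 ?_
  rintro _ ⟨d, ⟨hd, hdx⟩, rfl⟩
  refine hE _ _ fun e he hef => ?_
  have hstep := h (step hb d e)
    (step_wayBelow hb (he.trans_le (step_apply_of_wayBelow hb e hd).ge))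
    (step_le_of_le hb hef) x
  rwa [step_apply_of_wayBelow hb e (hd.trans_le hdx)] at hstep

lemma isBoundedComplete (hE : IsBoundedComplete E) : IsBoundedComplete (ScottMap D E) := by
  rintro S ⟨f, hf⟩
  obtain ⟨g, hg⟩ := exists_isLUB_of_forall fun x =>
    hE ((fun g : ScottMap D E => g.1 x) '' S) ⟨f.1 x, by
      rintro _ ⟨k, hk, rfl⟩
      exact hf hk x⟩
  exact ⟨g, isLUB_of_forall hg⟩

lemma scottContinuous_eval [IsLDomain E] :
    ScottContinuous fun p : D × ScottMap D E => p.2.1 p.1 :=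
  .fromProd (fun _ _ hS hd _ ha => isLUB_apply hS hd ha _) fun f => f.2

lemma scottContinuous_prodMk_left (b : E) : ScottContinuous fun a : D => (a, b) :=
  .prodMk .id (.const b)

lemma scottContinuous_prodMk_right (a : D) : ScottContinuous fun b : E => (a, b) :=
  .prodMk (.const a) .id

/-- Currying of Scott-continuous functions. -/
def curryEquiv [IsLDomain F] : ScottMap (D × E) F ≃ ScottMap E (ScottMap D F) where
  toFun f := ⟨fun y => ⟨fun x => f.1 (x, y), (scottContinuous_prodMk_left y).comp f.2⟩,
    fun _ hS hd _ ha => isLUB_of_forall fun x => by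
      rw [Set.image_image]
      exact ((scottContinuous_prodMk_right x).comp f.2) hS hd ha⟩
  invFun g := ⟨fun p => (g.1 p.2).1 p.1,
    (ScottContinuous.fst.prodMk (ScottContinuous.snd.comp g.2)).comp scottContinuous_eval⟩
  left_inv _ := rfl
  right_inv _ := rfl

end ScottMap

lemma OrderIso.scottContinuous (e : D ≃o E) : ScottContinuous e :=
  fun _ _ _ _ ha => e.isLUB_image'.2 ha

end DomainTheory

/-- A class of continuous L-domains that contains the one-point domain and is closed under binary
products and function spaces. -/
structure LDomainClass where
  /-- membership in the class -/
  Mem : ∀ (D : Type u) [PartialOrder D], Prop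
  isLDomain : ∀ {D : Type u} [PartialOrder D], Mem D → IsLDomain D
  punit : Mem PUnit.{u + 1}
  prod : ∀ {D E : Type u} [PartialOrder D] [PartialOrder E], Mem D → Mem E → Mem (D × E)
  scottMap : ∀ {D E : Type u} [PartialOrder D] [PartialOrder E],
    Mem D → Mem E → Mem (ScottMap D E)

/-- Bundled L-domains of a given class. -/
structure LDom (P : LDomainClass.{u}) where
  /-- the underlying type -/
  carrier : Type u
  [order : PartialOrder carrier]
  mem : P.Mem carrier

/-! ### Cartesian closed categories of L-domains -/

namespace LDom

variable {P : LDomainClass.{u}}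

instance : CoeSort (LDom P) (Type u) := ⟨carrier⟩

instance (X : LDom P) : PartialOrder X := X.order

instance (X : LDom P) : IsLDomain X := P.isLDomain X.mem

instance : Category.{u} (LDom P) where
  Hom X Y := ScottMap X Y
  id X := ⟨id, .id⟩
  comp f g := ⟨g.1 ∘ f.1, f.2.comp g.2⟩

lemma hom_ext {X Y : LDom P} {f g : X ⟶ Y} (h : ∀ x, f.1 x = g.1 x) : f = g :=
  Subtype.ext (funext h)

open Limits

/-- The one-point domain is terminal. -/
def terminalCone : LimitCone (Functor.empty.{0} (LDom P)) where
  cone := asEmptyCone ⟨PUnit, P.punit⟩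
  isLimit := IsTerminal.ofUniqueHom (fun _ => ⟨fun _ => ⟨⟩, .const _⟩)
    fun _ _ => hom_ext fun _ => rfl

/-- The product order is the categorical product. -/
def prodCone (X Y : LDom P) : LimitCone (pair X Y) where
  cone := BinaryFan.mk (P := ⟨X × Y, P.prod X.mem Y.mem⟩) ⟨Prod.fst, .fst⟩ ⟨Prod.snd, .snd⟩
  isLimit := BinaryFan.IsLimit.mk _ (fun f g => ⟨fun t => (f.1 t, g.1 t), f.2.prodMk g.2⟩)
    (fun _ _ => rfl) (fun _ _ => rfl) fun f g m hf hg => by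
      subst hf hg
      rfl

instance : CartesianMonoidalCategory (LDom P) :=
  .ofChosenFiniteProducts terminalCone prodCone

/-- The function space. -/
abbrev exp (X Y : LDom P) : LDom P := ⟨ScottMap X Y, P.scottMap X.mem Y.mem⟩

instance : MonoidalClosed (LDom P) where
  closed X :=
    { rightAdj := Adjunction.rightAdjointOfEquiv (F := MonoidalCategory.tensorLeft X)
        (G_obj := exp X) (fun Y Z => ScottMap.curryEquiv (D := X) (E := Y) (F := Z))
        fun _ _ _ _ _ => rfl
      adj := Adjunction.adjunctionOfEquivRight _ _ }

lemma isCartesianClosed_of_equivalence {C : Type v} [Category.{u} C] (e : LDom P ≌ C) :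
    IsCartesianClosed C := by
  have : HasFiniteProducts C :=
    ⟨fun _ => Adjunction.hasLimitsOfShape_of_equivalence e.inverse⟩
  let _ : CartesianMonoidalCategory C := .ofHasFiniteProducts
  exact ⟨inferInstance, ⟨cartesianClosedOfEquiv e⟩⟩

end LDom

/-! ### States of an information system -/

namespace ISW

open Set

variable {A B C : ISW.{u}}

/-- States of an information system: consistent, deductively closed sets of tokens in which every
token is derivable. -/
structure IsState (A : ISW.{u}) (x : Set A.Token) : Prop where
  consistent : ∀ F : Finset A.Token, ↑F ⊆ x → ∃ i ∈ x, A.Con i F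
  closed : ∀ {i a} {X : Finset A.Token}, i ∈ x → ↑X ⊆ x → A.Ent i X a → a ∈ x
  derivable : ∀ {a}, a ∈ x → ∃ i ∈ x, ∃ X : Finset A.Token, ↑X ⊆ x ∧ A.Ent i X a

/-- The states of an information system, ordered by inclusion. -/
abbrev State (A : ISW.{u}) := {x : Set A.Token // A.IsState x}

/-- The tokens to which `H` relates some `(i, X)` with `i ∈ x` and `X ⊆ T`. -/
def relImage (H : ApproxMap A B) (x T : Set A.Token) : Set B.Token :=
  {b | ∃ i ∈ x, ∃ X : Finset A.Token, ↑X ⊆ T ∧ H.Rel i X b}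

/-- Consistency of `x` gives one witness for finitely many pairs, and every relation moves to it.
Witnesses range over `x` while premises stay in `T`: this asymmetry is what local suprema need. -/
lemma exists_of_subset_relImage (H : ApproxMap A B) (x : A.State) {T : Set A.Token}
    (hT : T ⊆ x.1) (F : Finset B.Token) (hF : ↑F ⊆ relImage H x.1 T) :
    ∃ i ∈ x.1, ∃ X : Finset A.Token, ↑X ⊆ T ∧ A.Con i X ∧ ∀ b ∈ F, H.Rel i X b := by
  classical
  induction F using Finset.induction_on with
  | empty =>
    obtain ⟨i, hi, hc⟩ := x.2.consistent ∅ (by simp)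
    exact ⟨i, hi, ∅, by simp, hc, by simp⟩
  | insert b F _ ih =>
    rw [Finset.coe_insert, insert_subset_iff] at hF
    obtain ⟨i, hi, X, hX, hiX, hF'⟩ := ih hF.2
    obtain ⟨j, hj, Y, hY, hb⟩ := hF.1
    obtain ⟨k, hk, hc⟩ := x.2.consistent (insert i (insert j (X ∪ Y))) (by
      simp [insert_subset_iff, hi, hj, hX.trans hT, hY.trans hT])
    have hki : A.Con k {i} := A.con_subset (by simp) hc
    have hkj : A.Con k {j} := A.con_subset (by simp) hc
    have hXY : A.Con k (X ∪ Y) := A.con_subset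
      ((Finset.subset_insert _ _).trans (Finset.subset_insert _ _)) hc
    refine ⟨k, hk, X ∪ Y, by simp [hX, hY], hXY, fun c hc' => ?_⟩
    rcases Finset.mem_insert.1 hc' with rfl | hc'
    · exact H.rel_mono (A.con_wit hkj (H.con_of_rel hb)) hXY Finset.subset_union_right
        (H.rel_wit hkj (H.con_of_rel hb) hb)
    · exact H.rel_mono (A.con_wit hki hiX) hXY Finset.subset_union_left
        (H.rel_wit hki hiX (hF' c hc'))

lemma isState_relImage (H : ApproxMap A B) (x : A.State) {T : Set A.Token} (hT : T ⊆ x.1) :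
    B.IsState (relImage H x.1 T) where
  consistent F hF := by
    obtain ⟨i, hi, X, hX, hiX, h⟩ := exists_of_subset_relImage H x hT F hF
    obtain ⟨e, he, heF⟩ := H.rel_witness hiX h
    exact ⟨e, ⟨i, hi, X, hX, he⟩, heF⟩
  closed {j a Y} hj hY h := by
    classical
    obtain ⟨i, hi, X, hX, hiX, hF⟩ := exists_of_subset_relImage H x hT (insert j Y) (by
      simp [insert_subset_iff, hj, hY])
    exact ⟨i, hi, X, hX, H.rel_ent hiX (B.con_of_ent h) (hF j (Finset.mem_insert_self _ _))
      (fun y hy => hF y (Finset.mem_insert_of_mem hy)) h⟩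
  derivable := by
    rintro b ⟨i, hi, X, hX, h⟩
    obtain ⟨d, V, -, ⟨hd, hV⟩, hb⟩ := H.right_interp h
    exact ⟨d, ⟨i, hi, X, hX, hd⟩, V, fun v hv => ⟨i, hi, X, hX, hV v hv⟩, hb⟩

/-- The state of all tokens entailed by `(i, X)`. -/
def principal (A : ISW.{u}) {i : A.Token} {X : Finset A.Token} (h : A.Con i X) : A.State :=
  ⟨{a | A.Ent i X a},
    { consistent := fun _ hF => A.ent_witness h hF
      closed := fun hi hX => (ApproxMap.id A).rel_of_ent_pair hi hX
      derivable := fun ha =>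
        let ⟨d, V, _, ⟨hd, hV⟩, hb⟩ := (ApproxMap.id A).right_interp ha
        ⟨d, hd, V, hV, hb⟩ }⟩

lemma principal_le (A : ISW.{u}) {i : A.Token} {X : Finset A.Token} (h : A.Con i X) {x : A.State}
    (hi : i ∈ x.1) (hX : ↑X ⊆ x.1) : A.principal h ≤ x :=
  fun _ ha => x.2.closed hi hX ha

lemma principal_le_principal (A : ISW.{u}) {i j : A.Token} {X Y : Finset A.Token}
    {hX : A.Con i X} {hY : A.Con j Y} (h : ∀ {a}, A.Ent i X a → A.Ent j Y a) :
    A.principal hX ≤ A.principal hY :=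
  fun _ ha => h ha

lemma top_mem (x : A.State) : A.top ∈ x.1 := by
  obtain ⟨i, hi, -⟩ := x.2.consistent ∅ (by simp)
  exact x.2.closed (X := ∅) hi (by simp) (A.ent_top i)

lemma isBot_principal_top (A : ISW.{u}) : IsBot (A.principal (A.con_empty A.top)) :=
  fun x => A.principal_le _ (top_mem x) (by simp)

lemma exists_mem_of_finset {S : Set A.State} (hS : S.Nonempty) (hd : DirectedOn (· ≤ ·) S)
    {F : Finset A.Token} (hF : ∀ a ∈ F, ∃ y ∈ S, a ∈ y.1) : ∃ y ∈ S, ↑F ⊆ y.1 :=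
  DirectedOn.exists_mem_subset_of_finset_subset_biUnion (f := fun y : A.State => y.1) hS hd
    fun a ha => by simpa using hF a ha

/-- The union of a nonempty directed set of states. -/
def directedUnion {S : Set A.State} (hS : S.Nonempty) (hd : DirectedOn (· ≤ ·) S) : A.State :=
  ⟨{a | ∃ y ∈ S, a ∈ y.1},
    { consistent := fun F hF => by
        obtain ⟨y, hy, hFy⟩ := exists_mem_of_finset hS hd hF
        obtain ⟨i, hi, h⟩ := y.2.consistent F hFy
        exact ⟨i, ⟨y, hy, hi⟩, h⟩
      closed := by
        rintro i a X ⟨z, hz, hi⟩ hX h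
        obtain ⟨y, hy, hXy⟩ := exists_mem_of_finset hS hd hX
        obtain ⟨w, hw, hzw, hyw⟩ := hd z hz y hy
        exact ⟨w, hw, w.2.closed (hzw hi) (hXy.trans hyw) h⟩
      derivable := by
        rintro a ⟨y, hy, ha⟩
        obtain ⟨i, hi, X, hX, h⟩ := y.2.derivable ha
        exact ⟨i, ⟨y, hy, hi⟩, X, fun b hb => ⟨y, hy, hX hb⟩, h⟩ }⟩

lemma isLUB_directedUnion {S : Set A.State} (hS : S.Nonempty) (hd : DirectedOn (· ≤ ·) S) :
    IsLUB S (directedUnion hS hd) :=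
  ⟨fun y hy _ ha => ⟨y, hy, ha⟩, fun _ hu _ ⟨_, hy, ha⟩ => hu hy ha⟩

lemma mem_iff_of_isLUB {S : Set A.State} (hS : S.Nonempty) (hd : DirectedOn (· ≤ ·) S)
    {s : A.State} (hs : IsLUB S s) {a : A.Token} : a ∈ s.1 ↔ ∃ y ∈ S, a ∈ y.1 := by
  rw [hs.unique (isLUB_directedUnion hS hd)]
  rfl

lemma isLUB_of_forall_mem {S : Set A.State} {s : A.State}
    (h : ∀ a, a ∈ s.1 ↔ ∃ y ∈ S, a ∈ y.1) : IsLUB S s :=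
  ⟨fun y hy a ha => (h a).2 ⟨y, hy, ha⟩, fun _ hu a ha =>
    let ⟨_, hy, hay⟩ := (h a).1 ha
    hu hy hay⟩

/-- Directed suprema are unions, and the finite set `{i} ∪ X` lies in a single member. -/
lemma principal_wayBelow (A : ISW.{u}) {i : A.Token} {X : Finset A.Token} (h : A.Con i X)
    {x : A.State} (hi : i ∈ x.1) (hX : ↑X ⊆ x.1) : WayBelow (A.principal h) x := by
  classical
  intro S hS hd s hs hxs
  obtain ⟨y, hy, hiX⟩ := exists_mem_of_finset hS hd (F := insert i X) fun a ha =>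
    (mem_iff_of_isLUB hS hd hs).1 (hxs (by
      rcases Finset.mem_insert.1 ha with rfl | ha
      exacts [hi, hX ha]))
  rw [Finset.coe_insert, insert_subset_iff] at hiX
  exact ⟨y, hy, A.principal_le h hiX.1 hiX.2⟩

lemma isLocalLUB_relImage {x : A.State} {S : Set A.State} (hS : S ⊆ Iic x) :
    IsLocalLUB x S ⟨relImage (ApproxMap.id A) x.1 (⋃ y ∈ S, y.1),
      isState_relImage _ x (iUnion₂_subset fun _ hy => hS hy)⟩ := by
  refine ⟨⟨fun y hy a ha => ?_, ?_⟩, ?_⟩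
  · obtain ⟨i, hi, X, hX, h⟩ := y.2.derivable ha
    exact ⟨i, hS hy hi, X, hX.trans (subset_biUnion_of_mem (u := fun y : A.State => y.1) hy), h⟩
  · rintro a ⟨i, hi, X, hX, h⟩
    exact x.2.closed hi (hX.trans (iUnion₂_subset fun _ hy => hS hy)) h
  · rintro u ⟨hu, hux⟩ a ⟨i, hi, X, hX, h⟩
    have hXu : ↑X ⊆ u.1 := hX.trans (iUnion₂_subset fun _ hy => hu hy)
    obtain ⟨j, hj, hjX⟩ := u.2.consistent X hXu
    classical
    -- The witness `i` need not belong to `u`. Since `i` and `j` both lie in `x`, a common `k` lets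
    -- the entailment pass from `i` up to `k` and down to `j`.
    obtain ⟨k, -, hk⟩ := x.2.consistent {i, j} (by
      simpa [insert_subset_iff, hi] using hux hj)
    have hki : A.Con k {i} := A.con_subset (by simp) hk
    have hkj : A.Con k {j} := A.con_subset (by simp) hk
    exact u.2.closed hj hXu (A.ent_conserv hkj hjX (A.ent_wit hki (A.con_of_ent h) h))

instance (A : ISW.{u}) : IsLDomain A.State where
  exists_isBot := ⟨_, A.isBot_principal_top⟩
  exists_isLUB _ hS hd := ⟨_, isLUB_directedUnion hS hd⟩
  exists_isLocalLUB _ _ hS := ⟨_, isLocalLUB_relImage hS⟩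
  le_of_wayBelow x y h a ha := by
    obtain ⟨i, hi, X, hX, ha⟩ := x.2.derivable ha
    exact h _ (A.principal_wayBelow (A.con_of_ent ha) hi hX) ha

/-- A reflexive pair lies inside its own principal state, which is therefore compact. -/
lemma ALG.isAlgebraicDomain (hA : A.ALG) : IsAlgebraicDomain A.State := by
  intro x y h a ha
  obtain ⟨i, hi, X, hX, ha⟩ := x.2.derivable ha
  obtain ⟨j, V, ⟨hjV, hj, hV⟩, ⟨hij, hiV⟩, hF⟩ :=
    hA i X {a} (A.con_of_ent ha) (by simpa using ha)
  exact h (A.principal hjV) (A.principal_wayBelow hjV hj hV)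
    (A.principal_le hjV (x.2.closed hi hX hij) fun v hv => x.2.closed hi hX (hiV v hv))
    (hF a (by simp))

/-- By (BC) entailment ignores the witness, so the local supremum lies below every upper bound, even
one outside the ideal of `x`. -/
lemma BC.isBoundedComplete (hA : A.BC) : IsBoundedComplete A.State := by
  rintro S ⟨x, hx⟩
  have hs := isLocalLUB_relImage (x := x) (S := S) fun _ hy => hx hy
  refine ⟨_, hs.mem_upperBounds, ?_⟩
  rintro u hu a ⟨i, hi, X, hX, h⟩
  have hXu : ↑X ⊆ u.1 := hX.trans (iUnion₂_subset fun _ hy => hu hy)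
  obtain ⟨j, hj, hjX⟩ := u.2.consistent X hXu
  exact u.2.closed hj hXu ((hA X i j (A.con_of_ent h) hjX a).1 h)

/-- The action of an approximable mapping on states. -/
def stateMap (H : ApproxMap A B) : ScottMap A.State B.State :=
  ⟨fun x => ⟨relImage H x.1 x.1, isState_relImage H x subset_rfl⟩, by
    classical
    intro S hS hd s hs
    refine isLUB_of_forall_mem fun b => ⟨?_, ?_⟩
    · rintro ⟨i, hi, X, hX, h⟩
      obtain ⟨y, hy, hiX⟩ := exists_mem_of_finset hS hd (F := insert i X) fun a ha =>
        (mem_iff_of_isLUB hS hd hs).1 (by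
          rcases Finset.mem_insert.1 ha with rfl | ha
          exacts [hi, hX ha])
      rw [Finset.coe_insert, insert_subset_iff] at hiX
      exact ⟨_, ⟨y, hy, rfl⟩, i, hiX.1, X, hiX.2, h⟩
    · rintro ⟨_, ⟨y, hy, rfl⟩, i, hi, X, hX, h⟩
      exact ⟨i, hs.1 hy hi, X, hX.trans (hs.1 hy), h⟩⟩

lemma stateMap_id (x : A.State) : (stateMap (ApproxMap.id A)).1 x = x := by
  refine Subtype.ext (Set.ext fun a => ⟨?_, x.2.derivable⟩)
  rintro ⟨i, hi, X, hX, h⟩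
  exact x.2.closed hi hX h

lemma stateMap_comp (H : ApproxMap A B) (G : ApproxMap B C) (x : A.State) :
    (stateMap (H.comp G)).1 x = (stateMap G).1 ((stateMap H).1 x) := by
  classical
  refine Subtype.ext (Set.ext fun c => ⟨?_, ?_⟩)
  · rintro ⟨i, hi, X, hX, j, Y, -, ⟨hj, hY⟩, h⟩
    exact ⟨j, ⟨i, hi, X, hX, hj⟩, Y, fun y hy => ⟨i, hi, X, hX, hY y hy⟩, h⟩
  · rintro ⟨j, hj, Y, hY, h⟩
    obtain ⟨i, hi, X, hX, -, hF⟩ := exists_of_subset_relImage H x subset_rfl (insert j Y) (by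
      rw [Finset.coe_insert, insert_subset_iff]
      exact ⟨hj, hY⟩)
    exact ⟨i, hi, X, hX, j, Y, G.con_of_rel h, ⟨hF j (Finset.mem_insert_self _ _),
      fun y hy => hF y (Finset.mem_insert_of_mem hy)⟩, h⟩

lemma rel_iff_mem_stateMap (H : ApproxMap A B) {i : A.Token} {X : Finset A.Token} {b : B.Token}
    (hX : A.Con i X) : H.Rel i X b ↔ b ∈ ((stateMap H).1 (A.principal hX)).1 := by
  constructor
  · intro h
    obtain ⟨U, hU, hXU, hb⟩ := H.left_interp h
    obtain ⟨e, he, heU⟩ := A.ent_witness hX hXU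
    exact ⟨e, he, U, hXU, H.rel_conserv (A.con_singleton_of_ent he) heU hb⟩
  · rintro ⟨j, hj, Y, hY, h⟩
    exact H.rel_of_ent_pair hj hY h

lemma stateMap_injective : Function.Injective (stateMap : ApproxMap A B → _) := by
  intro H G h
  ext i X b
  constructor <;> intro hb
  · rwa [rel_iff_mem_stateMap G (H.con_of_rel hb), ← h, ← rel_iff_mem_stateMap]
  · rwa [rel_iff_mem_stateMap H (G.con_of_rel hb), h, ← rel_iff_mem_stateMap]

/-- Every state is the directed supremum of the principal states of pairs drawn from it, and `f`
preserves that supremum. -/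
lemma mem_apply_iff (f : ScottMap A.State B.State) (x : A.State) (b : B.Token) :
    b ∈ (f.1 x).1 ↔ ∃ i ∈ x.1, ∃ X : Finset A.Token, ↑X ⊆ x.1 ∧ ∃ h : A.Con i X,
      b ∈ (f.1 (A.principal h)).1 := by
  classical
  refine ⟨fun hb => ?_, ?_⟩
  · let S : Set A.State :=
      {y | ∃ i ∈ x.1, ∃ X : Finset A.Token, ↑X ⊆ x.1 ∧ ∃ h : A.Con i X, A.principal h = y}
    have hne : S.Nonempty :=
      ⟨_, A.top, top_mem x, ∅, by simp, A.con_empty _, rfl⟩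
    have hdir : DirectedOn (· ≤ ·) S := by
      rintro _ ⟨i, hi, X, hX, hiX, rfl⟩ _ ⟨j, hj, Y, hY, hjY, rfl⟩
      obtain ⟨k, hk, hc⟩ := x.2.consistent (insert i (insert j (X ∪ Y))) (by
        simp [insert_subset_iff, hi, hj, hX, hY])
      have hXY : A.Con k (X ∪ Y) := A.con_subset
        ((Finset.subset_insert _ _).trans (Finset.subset_insert _ _)) hc
      have hki : A.Con k {i} := A.con_subset (by simp) hc
      have hkj : A.Con k {j} := A.con_subset (by simp) hc
      exact ⟨_, ⟨k, hk, X ∪ Y, by simp [hX, hY], hXY, rfl⟩,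
        fun a ha => A.ent_mono (A.con_wit hki hiX) hXY Finset.subset_union_left
          (A.ent_wit hki hiX ha),
        fun a ha => A.ent_mono (A.con_wit hkj hjY) hXY Finset.subset_union_right
          (A.ent_wit hkj hjY ha)⟩
    have hlub : IsLUB S x := isLUB_of_forall_mem fun a => ⟨fun ha => by
      obtain ⟨i, hi, X, hX, h⟩ := x.2.derivable ha
      exact ⟨_, ⟨i, hi, X, hX, A.con_of_ent h, rfl⟩, h⟩, by
        rintro ⟨_, ⟨i, hi, X, hX, h, rfl⟩, ha⟩
        exact A.principal_le h hi hX ha⟩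
    obtain ⟨_, ⟨_, ⟨i, hi, X, hX, h, rfl⟩, rfl⟩, hb⟩ := (mem_iff_of_isLUB (hne.image f.1)
      (hdir.mono_comp fun _ _ hxy => f.2.monotone hxy) (f.2 hne hdir hlub)).1 hb
    exact ⟨i, hi, X, hX, h, hb⟩
  · rintro ⟨i, hi, X, hX, h, hb⟩
    exact f.2.monotone (A.principal_le h hi hX) hb

/-- The approximable mapping of a Scott-continuous function between states. -/
def ofScottMap (f : ScottMap A.State B.State) : ApproxMap A B where
  Rel i X b := ∃ h : A.Con i X, b ∈ (f.1 (A.principal h)).1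
  con_of_rel h := h.1
  rel_top := ⟨A.con_empty _, top_mem _⟩
  rel_mono := fun _ hX' hs ⟨hX, h⟩ =>
    ⟨hX', f.2.monotone (A.principal_le_principal (A.ent_mono hX hX' hs)) h⟩
  rel_of_ent := fun hX hXX' ⟨_, h⟩ =>
    ⟨hX, f.2.monotone (A.principal_le_principal (A.ent_trans hX hXX')) h⟩
  left_interp := by
    rintro i X b ⟨hX, h⟩
    obtain ⟨j, hj, Y, hY, hjY, hb⟩ := (mem_apply_iff f _ b).1 h
    have hij := A.con_singleton_of_ent hj
    -- Since `(i, X) ⊢ j` gives `{j} ∈ Con(i)`, the pair `(j, Y)` can be replaced by `(i, Y)`.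
    exact ⟨Y, A.con_wit hij hjY, hY, A.con_wit hij hjY,
      f.2.monotone (A.principal_le_principal (A.ent_wit hij hjY)) hb⟩
  rel_ent := fun _ _ ⟨hX, hk⟩ hY h => ⟨hX, (f.1 _).2.closed hk (fun y hy => (hY y hy).2) h⟩
  right_interp := by
    rintro i X b ⟨hX, h⟩
    obtain ⟨d, hd, V, hV, hb⟩ := (f.1 _).2.derivable h
    exact ⟨d, V, B.con_of_ent hb, ⟨⟨hX, hd⟩, fun v hv => ⟨hX, hV hv⟩⟩, hb⟩
  rel_witness hX hF :=
    let ⟨e, he, heF⟩ := (f.1 _).2.consistent _ fun b hb => (hF b hb).2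
    ⟨e, ⟨hX, he⟩, heF⟩
  rel_wit := fun hij hX ⟨_, h⟩ =>
    ⟨A.con_wit hij hX, f.2.monotone (A.principal_le_principal (A.ent_wit hij hX)) h⟩
  rel_conserv := fun hij hX ⟨_, h⟩ =>
    ⟨hX, f.2.monotone (A.principal_le_principal (A.ent_conserv hij hX)) h⟩

lemma stateMap_ofScottMap (f : ScottMap A.State B.State) : stateMap (ofScottMap f) = f :=
  Subtype.ext (funext fun x => Subtype.ext (Set.ext fun b => (mem_apply_iff f x b).symm))

/-! ### From L-domains back to information systems -/

section OfLDomain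

variable (D : Type u) [PartialOrder D] [IsLDomain D]

/-- The information system of a continuous L-domain: the tokens are all elements, and `(i, X)`
entails what is way below the supremum of `X` in the principal ideal of `i`. -/
noncomputable abbrev ofLDomain : ISW.{u} where
  Token := D
  Con i X := ↑X ⊆ Iic i
  Ent i X a := ∃ s, IsLocalLUB i (X : Set D) s ∧ WayBelow a s
  top := (IsLDomain.exists_isBot (D := D)).choose
  con_of_ent := fun ⟨_, hs, _⟩ => hs.subset_Iic
  con_self i := by simp
  con_subset hYX hX := (Finset.coe_subset.2 hYX).trans hX
  ent_top i :=
    let ⟨s, hs⟩ := IsLDomain.exists_isLocalLUB i ((∅ : Finset D) : Set D) (by simp)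
    ⟨s, hs, .of_isBot (IsLDomain.exists_isBot (D := D)).choose_spec s⟩
  con_of_ent_all _ h y hy :=
    let ⟨_, hs, hys⟩ := h y hy
    hys.le.trans hs.le
  ent_mono := fun _ hY hXY ⟨_, hs, ha⟩ =>
    let ⟨t, ht⟩ := IsLDomain.exists_isLocalLUB _ _ hY
    ⟨t, ht, ha.trans_le (hs.2 ⟨fun _ hx => ht.1.1 (hXY hx), ht.le⟩)⟩
  ent_trans := by
    rintro i X Y a hX hXY ⟨t, ht, ha⟩
    obtain ⟨s, hs⟩ := IsLDomain.exists_isLocalLUB _ _ hX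
    refine ⟨s, hs, ha.trans_le (ht.2 ⟨fun y hy => ?_, hs.le⟩)⟩
    obtain ⟨s', hs', hys⟩ := hXY y hy
    exact hs.unique hs' ▸ hys.le
  ent_interp := by
    rintro i X a ⟨s, hs, ha⟩
    -- An interpolant serves as a one-element premise, being its own supremum.
    obtain ⟨z, haz, hzs⟩ := ha.exists_between
    have hzi : z ≤ i := hzs.le.trans hs.le
    refine ⟨{z}, by simpa using hzi, by simpa using ⟨s, hs, hzs⟩, z, ?_, haz⟩
    exact ⟨⟨by simp, hzi⟩, fun u hu => hu.1 (by simp)⟩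
  ent_witness := by
    intro i X Y hX hY
    obtain ⟨s, hs⟩ := IsLDomain.exists_isLocalLUB _ _ hX
    obtain ⟨e, he, hYe⟩ := exists_wayBelow_forall_le (x := s) Y.finite_toSet fun y hy => by
      obtain ⟨s', hs', hys⟩ := hY y hy
      exact hs.unique hs' ▸ hys
    exact ⟨e, ⟨s, hs, he⟩, hYe⟩
  con_wit hij hX := hX.trans (Iic_subset_Iic.2 (by simpa using hij))
  ent_wit := fun hij _ ⟨s, hs, ha⟩ => ⟨s, hs.of_le (by simpa using hij), ha⟩
  ent_conserv := by
    rintro i j X a hij hX ⟨s, hs, ha⟩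
    obtain ⟨t, ht⟩ := IsLDomain.exists_isLocalLUB _ _ hX
    exact ⟨t, ht, ht.unique_of_le hs (by simpa using hij) ▸ ha⟩

variable {D}

lemma ofLDomain_ent_of_wayBelow {a z i : D} (haz : WayBelow a z) (hzi : z ≤ i) :
    (ofLDomain D).Ent i ({z} : Finset D) a :=
  ⟨z, ⟨⟨by simp, hzi⟩, fun u hu => hu.1 (by simp)⟩, haz⟩

/-- In an algebraic domain finitely many elements way below `s` lie under one compact `k ≤ s`; the
pair `(k, {k})` is then reflexive. -/
lemma alg_ofLDomain (hD : IsAlgebraicDomain D) : (ofLDomain D).ALG := by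
  intro i X F hX hF
  obtain ⟨s, hs⟩ := IsLDomain.exists_isLocalLUB _ _ hX
  have hFs : ∀ a ∈ F, ∃ k ∈ {k | WayBelow k k ∧ k ≤ s}, a ≤ k := fun a ha => by
    obtain ⟨s', hs', has⟩ := hF a ha
    rw [← hs.unique hs'] at has
    exact has _ (nonempty_compact s) (directedOn_compact s) s (hD.isLUB_compact s) le_rfl
  obtain ⟨k, ⟨hk, hks⟩, hFk⟩ :=
    (directedOn_compact s).exists_forall_le_of_finite (nonempty_compact s) F.finite_toSet hFs
  have hkk := ofLDomain_ent_of_wayBelow hk le_rfl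
  have hik : (ofLDomain D).Ent i X k := ⟨s, hs, hk.trans_le hks⟩
  refine ⟨k, ({k} : Finset D), ⟨(ofLDomain D).con_self k, hkk, ?_⟩, ⟨hik, ?_⟩, fun a ha =>
    ofLDomain_ent_of_wayBelow (.of_le (hFk a ha) hk) le_rfl⟩
  · intro v hv
    rwa [Finset.mem_singleton.1 hv]
  · intro v hv
    rwa [Finset.mem_singleton.1 hv]

lemma bc_ofLDomain (hD : IsBoundedComplete D) : (ofLDomain D).BC := by
  have key : ∀ (X : Finset D) (i j a : D), (ofLDomain D).Con j X → (ofLDomain D).Ent i X a →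
      (ofLDomain D).Ent j X a := by
    rintro X i j a hj ⟨s, hs, ha⟩
    obtain ⟨t, ht⟩ := hD X ⟨j, hj⟩
    have hst : s ≤ t := hs.2 ⟨ht.1, ht.2 hs.subset_Iic⟩
    exact ⟨t, ⟨⟨ht.1, ht.2 hj⟩, fun u hu => ht.2 hu.1⟩, ha.trans_le hst⟩
  exact fun X i j hi hj a => ⟨key X i j a hj, key X j i a hi⟩

/-- The state of all elements way below a given one. -/
def wayBelowState (d : D) : (ofLDomain D).State :=
  ⟨{a : D | WayBelow a d},
    { consistent := fun F hF =>
        let ⟨e, he, h⟩ := exists_wayBelow_forall_le (x := d) F.finite_toSet hF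
        ⟨e, he, h⟩
      closed := fun hi _ ⟨_, hs, ha⟩ => ha.trans_le (hs.le.trans (WayBelow.le hi))
      derivable := fun ha =>
        let ⟨z, haz, hzd⟩ := WayBelow.exists_between ha
        ⟨z, hzd, ({z} : Finset D), by simpa using mem_ofPred.2 hzd, ofLDomain_ent_of_wayBelow haz le_rfl⟩ }⟩

lemma wayBelowState_surjective : Function.Surjective (wayBelowState (D := D)) := by
  classical
  intro x
  have hne : (x.1 : Set D).Nonempty := ⟨_, top_mem x⟩
  -- Consistency here means having an upper bound in the state, so states are directed.
  have hdir : DirectedOn (· ≤ ·) (x.1 : Set D) := by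
    intro a ha b hb
    obtain ⟨i, hi, h⟩ := x.2.consistent ({a, b} : Finset D) (by
      rintro c hc
      rcases Finset.mem_insert.1 (Finset.mem_coe.1 hc) with rfl | hc
      · exact ha
      · rwa [Finset.mem_singleton.1 hc])
    exact ⟨i, hi, h (show a ∈ ({a, b} : Finset D) by simp),
      h (show b ∈ ({a, b} : Finset D) by simp)⟩
  obtain ⟨s, hs⟩ := IsLDomain.exists_isLUB (D := D) x.1 hne hdir
  refine ⟨s, Subtype.ext (Set.ext fun a => ⟨fun ha => ?_, fun ha => ?_⟩)⟩
  -- Interpolating below `s` gives `a ≪ i` with `i` in the state; any derivation of `i` then also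
  -- derives `a`.
  · obtain ⟨i, hi, hai⟩ := WayBelow.exists_between (D := D) ha |>.elim fun z hz =>
      let ⟨i, hi, hzi⟩ := hz.2 x.1 hne hdir s hs le_rfl
      (⟨i, hi, hz.1.trans_le hzi⟩ : ∃ i ∈ (x.1 : Set D), WayBelow a i)
    obtain ⟨j, hj, Y, hY, t, ht, hit⟩ := x.2.derivable hi
    exact x.2.closed hj hY ⟨t, ht, hai.trans_le hit.le⟩
  · obtain ⟨j, hj, Y, hY, t, ht, hat⟩ := x.2.derivable ha
    exact hat.trans_le (ht.le.trans (hs.1 hj))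

variable (D) in
/-- A continuous L-domain is isomorphic to the states of its information system. -/
noncomputable def orderIsoState : D ≃o (ofLDomain D).State :=
  RelIso.ofSurjective (OrderEmbedding.ofMapLEIff wayBelowState fun x y =>
    ⟨fun h => IsLDomain.le_of_wayBelow x y fun a ha => WayBelow.le (@h a ha),
      fun h _ ha => WayBelow.trans_le ha h⟩) wayBelowState_surjective

end OfLDomain

end ISW

/-- All continuous L-domains. -/
def LDomainClass.all : LDomainClass.{u} where
  Mem D _ := IsLDomain D
  isLDomain h := h
  punit := inferInstance
  prod hD hE := by
    have := hD
    have := hE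
    infer_instance
  scottMap hD hE := by
    have := hD
    have := hE
    infer_instance

/-- Algebraic L-domains. -/
def LDomainClass.algebraic : LDomainClass.{u} where
  Mem D _ := IsLDomain D ∧ IsAlgebraicDomain D
  isLDomain h := h.1
  punit := ⟨inferInstance, isAlgebraicDomain_punit⟩
  prod hD hE := by
    have := hD.1
    have := hE.1
    exact ⟨inferInstance, hD.2.prod hE.2⟩
  scottMap hD hE := by
    have := hD.1
    have := hE.1
    exact ⟨inferInstance, ScottMap.isAlgebraicDomain hD.2 hE.2⟩

/-- Bounded-complete continuous domains. -/
def LDomainClass.boundedComplete : LDomainClass.{u} where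
  Mem D _ := IsLDomain D ∧ IsBoundedComplete D
  isLDomain h := h.1
  punit := ⟨inferInstance, isBoundedComplete_punit⟩
  prod hD hE := by
    have := hD.1
    have := hE.1
    exact ⟨inferInstance, hD.2.prod hE.2⟩
  scottMap hD hE := by
    have := hD.1
    have := hE.1
    exact ⟨inferInstance, ScottMap.isBoundedComplete hE.2⟩

/-- The intersection of two classes of L-domains. -/
def LDomainClass.inter (P Q : LDomainClass.{u}) : LDomainClass.{u} where
  Mem D _ := P.Mem D ∧ Q.Mem D
  isLDomain h := P.isLDomain h.1
  punit := ⟨P.punit, Q.punit⟩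
  prod hD hE := ⟨P.prod hD.1 hE.1, Q.prod hD.2 hE.2⟩
  scottMap hD hE := ⟨P.scottMap hD.1 hE.1, Q.scottMap hD.2 hE.2⟩

/-! ### Equivalence of categories and transfer -/

namespace LDom

variable {P : LDomainClass.{u}}

/-- Order isomorphisms are isomorphisms of L-domains. -/
def isoOfOrderIso {X Y : LDom P} (e : X ≃o Y) : X ≅ Y where
  hom := ⟨e, e.scottContinuous⟩
  inv := ⟨e.symm, e.symm.scottContinuous⟩
  hom_inv_id := hom_ext e.symm_apply_apply
  inv_hom_id := hom_ext e.apply_symm_apply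

end LDom

namespace ISW

variable {C : Type v} [Category.{u} C]

/-- The functor of states, from a category over `ISW` to L-domains. -/
def stateFunctor (P : LDomainClass.{u}) (G : C ⥤ ISW.{u}) (h : ∀ c, P.Mem (G.obj c).State) :
    C ⥤ LDom P where
  obj c := ⟨(G.obj c).State, h c⟩
  map f := stateMap (G.map f)
  map_id c := by
    rw [G.map_id]
    exact Subtype.ext (funext stateMap_id)
  map_comp f g := by
    rw [G.map_comp]
    exact Subtype.ext (funext (stateMap_comp _ _))

/-- A category fully faithfully embedded in `ISW` is Cartesian closed if its objects correspond to
the domains in a class of L-domains. -/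
lemma isCartesianClosed_of_fullyFaithful (P : LDomainClass.{u}) (G : C ⥤ ISW.{u}) [G.Full]
    [G.Faithful] (h : ∀ c, P.Mem (G.obj c).State)
    (hsurj : ∀ (D : Type u) [PartialOrder D] [IsLDomain D], P.Mem D →
      ∃ c, G.obj c = ofLDomain D) : IsCartesianClosed C := by
  have : (stateFunctor P G h).Faithful :=
    ⟨fun hfg => G.map_injective (stateMap_injective hfg)⟩
  have : (stateFunctor P G h).Full := ⟨fun {c d} f =>
    ⟨G.preimage (ofScottMap f : G.obj c ⟶ G.obj d), by
      change stateMap (G.map (G.preimage _)) = f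
      rw [G.map_preimage]
      exact stateMap_ofScottMap f⟩⟩
  have : (stateFunctor P G h).EssSurj := ⟨fun X => by
    obtain ⟨c, hc⟩ := hsurj X X.mem
    have e : X ≃o (G.obj c).State := hc ▸ orderIsoState X
    exact ⟨c, ⟨(LDom.isoOfOrderIso (Y := (stateFunctor P G h).obj c) e).symm⟩⟩⟩
  have : (stateFunctor P G h).IsEquivalence := {}
  exact LDom.isCartesianClosed_of_equivalence (stateFunctor P G h).asEquivalence.symm

end ISW

theorem mainTheorem1 :
    IsCartesianClosed ISW.{u} ∧ IsCartesianClosed aISW.{u} ∧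
      IsCartesianClosed bcISW.{u} ∧ IsCartesianClosed abcISW.{u} :=
  ⟨ISW.isCartesianClosed_of_fullyFaithful .all (𝟭 ISW.{u}) (fun _ => inferInstanceAs (IsLDomain _))
      fun D _ _ _ => ⟨ISW.ofLDomain D, rfl⟩,
    ISW.isCartesianClosed_of_fullyFaithful .algebraic (ObjectProperty.ι _)
      (fun A => ⟨inferInstance, A.property.isAlgebraicDomain⟩)
      fun D _ _ hD => ⟨⟨ISW.ofLDomain D, ISW.alg_ofLDomain hD.2⟩, rfl⟩,
    ISW.isCartesianClosed_of_fullyFaithful .boundedComplete (ObjectProperty.ι _)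
      (fun A => ⟨inferInstance, A.property.isBoundedComplete⟩)
      fun D _ _ hD => ⟨⟨ISW.ofLDomain D, ISW.bc_ofLDomain hD.2⟩, rfl⟩,
    ISW.isCartesianClosed_of_fullyFaithful (.inter .algebraic .boundedComplete)
      (ObjectProperty.ι _)
      (fun A => ⟨⟨inferInstance, A.property.1.isAlgebraicDomain⟩,
        ⟨inferInstance, A.property.2.isBoundedComplete⟩⟩)
      fun D _ _ hD => ⟨⟨ISW.ofLDomain D, ISW.alg_ofLDomain hD.1.2, ISW.bc_ofLDomain hD.2.2⟩, rfl⟩⟩
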